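/- Let $x_1,\dots,x_n$ be pairwise distinct points of $\mathbb R$, and let $1\le r\le m\le n$ be integers. Put $D^{(p)}=[\,|x_i-x_j|^p\,]_{i,j=1}^n$ and let $V_{\le r-1}=[\,x_i^{\,j}\,]_{1\le i\le n,\;0\le j\le r-1}\in\mathbb R^{n\times r}$. Definitions. A stationary kernel on $\mathbb R$ is a positive definite function $\kappa(x,y)=f(|x-y|)$ (all matrices $[\kappa(y_i,y_j)]$ are positive semi-definite) with $f$ analytic at $0$, $f(t)=\sum_i f_i t^i$; its smoothness order is $\min\{s\ge 1: f_{2s-1}\ne 0\}$. For $\varepsilon>0$ let $\kappa_\varepsilon(x,y)=f(\varepsilon|x-y|)$ and $L_\varepsilon=[\kappa_\varepsilon(x_i,x_j)]_{i,j}$. For a positive semi-definite $L\in\mathbb R^{n\times n}$, the fixed-size L-ensemble $|DPP|_m(L)$ is the random subset of $\{1,\dots,n\}$ with $\mathbb P(\mathcal X=X)=\det L_X/\sum_{|Y|=m}\det L_Y$ if $|X|=m$, and $0$ otherwise. A pair $(L;V)$, with $L\in\mathbb R^{n\times n}$ symmetric and $V\in\mathbb R^{n\times p}$ of rank $p$,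 is a nonnegative pair if $c^\top Lc\ge 0$ for all $c$ with $V^\top c=0$; then $|DPP|_m(L;V)$ is the random subset with $$\mathbb P(\mathcal X=X)\ \propto\ (-1)^p\det\begin{pmatrix}L_X& V_{X,:}\\ (V_{X,:})^\top&0\end{pmatrix}\quad\text{if } |X|=m,$$ and $0$ otherwise (a partial-projection DPP when $p\ge 1$). Theorem. The pair $((-1)^rD^{(2r-1)};V_{\le r-1})$ is a nonnegative pair, and the law $\mathcal X_\star\sim|DPP|_m((-1)^rD^{(2r-1)};V_{\le r-1})$ is well defined; its normalised probabilities are unchanged if $(-1)^rD^{(2r-1)}$ is replaced by $D^{(2r-1)}$ in the determinants. For every stationary kernel $\kappa$ of smoothness order $r$, the fixed-size L-ensemble $\mathcal X_\varepsilon\sim|DPP|_m(L_\varepsilon)$ is well defined for all sufficiently small $\varepsilon>0$, and $\mathcal X_\varepsilon$ converges to $\mathcal X_\star$ as $\varepsilon\to0^+$, that is, $\mathbb P(\mathcal X_\varepsilon=X)\to\mathbb P(\mathcal X_\star=X)$ for every $X\subseteq\{1,\dots,n\}$. In particular, for given points and given $m$, the limit depends on the kernel only through $r$. -/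

import Mathlib

open Filter Topology

noncomputable section

namespace FlatLimit

/-- A symmetric real kernel is positive definite when all its kernel matrices are positive
semi-definite (the usual convention for positive definite functions; strictly positive definite
kernels are included). -/
def IsPosDefKernel (κ : ℝ → ℝ → ℝ) : Prop :=
  ∀ (N : ℕ) (y : Fin N → ℝ), (Matrix.of fun i j => κ (y i) (y j)).PosSemidef

/-- `κ` is the stationary kernel with radial profile `f`: a positive definite function of the form
`κ(x, y) = f(|x - y|)` with `f` analytic at `0`. -/
structure IsStationaryKernel (κ : ℝ → ℝ → ℝ) (f : ℝ → ℝ) : Prop where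
  posDef : IsPosDefKernel κ
  eq_profile : ∀ x y, κ x y = f |x - y|
  analyticAt_zero : AnalyticAt ℝ f 0

/-- The Taylor coefficient `f_i = f^(i)(0) / i!`. -/
def taylorCoeff (f : ℝ → ℝ) (i : ℕ) : ℝ := iteratedDeriv i f 0 / (i.factorial : ℝ)

/-- The smoothness order (a positive integer when finite) is `r = min {s | f_(2s-1) ≠ 0}`. -/
def HasSmoothnessOrder (f : ℝ → ℝ) (r : ℕ) : Prop :=
  IsLeast {s : ℕ | 1 ≤ s ∧ taylorCoeff f (2 * s - 1) ≠ 0} r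

/-- The kernel at inverse scale `ε`: `κ_ε(x, y) = κ(ε x, ε y)`, which is `f(ε |x - y|)` for `ε > 0`
when `κ` is stationary with profile `f`. -/
def scaledKernel (κ : ℝ → ℝ → ℝ) (ε : ℝ) (x y : ℝ) : ℝ := κ (ε * x) (ε * y)

/-- The matrix `L_ε = [κ_ε(x_i, x_j)]`. -/
def kernelMatrix {n : ℕ} (κ : ℝ → ℝ → ℝ) (x : Fin n → ℝ) (ε : ℝ) : Matrix (Fin n) (Fin n) ℝ :=
  Matrix.of fun i j => scaledKernel κ ε (x i) (x j)

/-- The matrix `D^(p) = [|x_i - x_j|^p]`. -/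
def distMatrix {n : ℕ} (x : Fin n → ℝ) (p : ℕ) : Matrix (Fin n) (Fin n) ℝ :=
  Matrix.of fun i j => |x i - x j| ^ p

/-- The Vandermonde matrix with the `k` columns `1, x, ..., x^(k-1)`, that is `V_{≤ k-1}`. -/
def vandermondeLT {n : ℕ} (x : Fin n → ℝ) (k : ℕ) : Matrix (Fin n) (Fin k) ℝ :=
  Matrix.of fun i j => x i ^ (j : ℕ)

/-- The principal minor `det L_X`. -/
def principalMinor {n : ℕ} (L : Matrix (Fin n) (Fin n) ℝ) (X : Finset (Fin n)) : ℝ :=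
  (L.submatrix (fun i : X => (i : Fin n)) (fun j : X => (j : Fin n))).det

/-- `P` is the law of the fixed-size L-ensemble `|DPP|_m(L)`: `L` is positive semi-definite and
`P(X) = det L_X / Z_m` if `|X| = m` and `P(X) = 0` otherwise, where `Z_m` is the sum of `det L_Y`
over all `Y` with `|Y| = m`. (There is no such law when `Z_m = 0`.) -/
def IsFixedSizeLEnsemble {n : ℕ} (L : Matrix (Fin n) (Fin n) ℝ) (m : ℕ)
    (P : PMF (Finset (Fin n))) : Prop :=
  L.PosSemidef ∧ ∀ X : Finset (Fin n), (P X).toReal =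
    if X.card = m then
      principalMinor L X / ∑ Y ∈ Finset.univ.powersetCard m, principalMinor L Y
    else 0

/-- `(L; V)` is a nonnegative pair: `L` is symmetric, `V` has full column rank `p`, and `L` is
positive semi-definite on the orthogonal complement of the column span of `V`. -/
structure IsNonnegativePair {n p : ℕ} (L : Matrix (Fin n) (Fin n) ℝ)
    (V : Matrix (Fin n) (Fin p) ℝ) : Prop where
  symm : L.IsSymm
  rank_eq : V.rank = p
  nonneg : ∀ c : Fin n → ℝ, V.transpose.mulVec c = 0 → 0 ≤ c ⬝ᵥ L.mulVec c

/-- The saddle-point determinant of the block matrix with rows `(L_X, V_X)` and `(V_Xᵀ, 0)`. -/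
def saddleDet {n p : ℕ} (L : Matrix (Fin n) (Fin n) ℝ) (V : Matrix (Fin n) (Fin p) ℝ)
    (X : Finset (Fin n)) : ℝ :=
  (Matrix.fromBlocks
    (L.submatrix (fun i : X => (i : Fin n)) (fun j : X => (j : Fin n)))
    (V.submatrix (fun i : X => (i : Fin n)) id)
    (V.submatrix (fun i : X => (i : Fin n)) id).transpose
    (0 : Matrix (Fin p) (Fin p) ℝ)).det

/-- The weight `(-1)^p det [L_X, V_X; V_Xᵀ, 0]` restricted to `|X| = m` and normalised by its sum
over all `Y` with `|Y| = m`. -/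
def fixedSizeExtendedMass {n p : ℕ} (L : Matrix (Fin n) (Fin n) ℝ) (V : Matrix (Fin n) (Fin p) ℝ)
    (m : ℕ) (X : Finset (Fin n)) : ℝ :=
  if X.card = m then
    ((-1) ^ p * saddleDet L V X) /
      ∑ Y ∈ Finset.univ.powersetCard m, (-1) ^ p * saddleDet L V Y
  else 0

/-- `P` is the law of the fixed-size (partial-projection, when `p ≥ 1`) DPP `|DPP|_m(L; V)`:
the extended L-ensemble of the nonnegative pair `(L; V)` conditioned on having size `m`. -/
def IsFixedSizePPDPP {n p : ℕ} (L : Matrix (Fin n) (Fin n) ℝ) (V : Matrix (Fin n) (Fin p) ℝ)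
    (m : ℕ) (P : PMF (Finset (Fin n))) : Prop :=
  IsNonnegativePair L V ∧
    ∀ X : Finset (Fin n), (P X).toReal = fixedSizeExtendedMass L V m X

end FlatLimit

end

namespace FlatLimit

open Matrix

/-! Fix `X` of size m = r + q with nodes z, let Q be their Vandermonde matrix and T its inverse: the
i-th row of T is a functional sending the monomial z^l to δ_il for l < m. In T K Tᵀ, with K =
[f(ε|z_i - z_j|)], an even power ε^k can survive in entry (i, j) only if k ≥ i + j, and an odd one
only if k ≥ 2r - 1. Dividing rows and columns by suitable powers of ε leaves a block lower
triangular limit, so ε^(-d) det K tends to (det Q)² · det W · f_(2r-1)^q · det B. Here W is an r × r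
Wronskian matrix depending on f alone, and B is the compression of D^(2r-1) to the functionals that
kill polynomials of degree < r.

The saddle-point determinant equals (det Q)² det B up to a sign independent of `X`. Normalisation
cancels every factor that depends on the kernel, provided none of them vanishes and the remaining
weights are positive. Two facts ensure this.

`sum_dist_pow_pos`: (-1)^r B is positive definite, because under the moment conditions the quadratic
form of (-1)^r |x - y|^(2r-1) is a positive multiple of the squared L² norm of a combination of
truncated powers.

`det_wronskianMatrix_ne_zero`: a null vector of W would, by Cauchy–Schwarz, give a differential
operator at 0 killing every nearby kernel section; f then solves two linear ODEs with constant
coefficients, which contradict f_(2r-1) ≠ 0. -/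

/-! ### Taylor expansion of scaled sums. -/

lemma taylorCoeff_isBigO {f : ℝ → ℝ} (hf : AnalyticAt ℝ f 0) (K : ℕ) :
    (fun t => f t - ∑ k ∈ Finset.range K, taylorCoeff f k * t ^ k) =O[𝓝 0] fun t => t ^ K := by
  have h := hf.hasFPowerSeriesAt.isBigO_sub_partialSum_pow K
  have h2 : (fun t : ℝ => ‖t‖ ^ K) =O[𝓝 0] fun t => t ^ K := by
    refine Asymptotics.IsBigO.of_norm_left ?_
    simpa using (Asymptotics.isBigO_refl (fun t : ℝ => t ^ K) (𝓝 0)).norm_left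
  refine (h.trans h2).congr_left fun t => ?_
  simp [FormalMultilinearSeries.partialSum, taylorCoeff, mul_comm]

/-- A scaled combination of values of an analytic function, divided by the order of its first
possibly nonzero term. -/
lemma tendsto_sum_scaled_div_pow {ι : Type*} [Fintype ι] {f : ℝ → ℝ} (hf : AnalyticAt ℝ f 0)
    -- The product form covers both reasons for a term to vanish: a zero moment or a zero
    -- coefficient.
    (β d : ι → ℝ) (s : ℕ) (h : ∀ k < s, taylorCoeff f k * ∑ i, β i * d i ^ k = 0) :
    Tendsto (fun ε => (∑ i, β i * f (ε * d i)) / ε ^ s) (𝓝[>] (0 : ℝ))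
      (𝓝 (taylorCoeff f s * ∑ i, β i * d i ^ s)) := by
  set R : ℝ → ℝ := fun t => f t - ∑ k ∈ Finset.range (s + 1), taylorCoeff f k * t ^ k with hR
  have hRO : R =O[𝓝 0] fun t => t ^ (s + 1) := taylorCoeff_isBigO hf (s + 1)
  have hi : ∀ i, (fun ε => β i * R (ε * d i)) =O[𝓝[>] (0 : ℝ)] fun ε => ε ^ (s + 1) := by
    intro i
    have ht : Tendsto (fun ε : ℝ => ε * d i) (𝓝[>] (0 : ℝ)) (𝓝 0) := by
      have : Tendsto (fun ε : ℝ => ε * d i) (𝓝 (0 : ℝ)) (𝓝 (0 * d i)) :=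
        (continuous_id.mul continuous_const).tendsto 0
      simpa using this.mono_left nhdsWithin_le_nhds
    have h1 := (hRO.comp_tendsto ht).const_mul_left (β i)
    refine h1.trans ?_
    have : ((fun t : ℝ => t ^ (s + 1)) ∘ fun ε => ε * d i)
        = fun ε => d i ^ (s + 1) * ε ^ (s + 1) := by
      funext ε
      simp only [Function.comp]
      ring
    rw [this]
    exact (Asymptotics.isBigO_refl _ _).const_mul_left _
  have hsum : (fun ε => ∑ i, β i * R (ε * d i)) =O[𝓝[>] (0 : ℝ)] fun ε => ε ^ (s + 1) :=
    Asymptotics.IsBigO.fun_sum fun i _ => hi i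
  have hlo : (fun ε => ∑ i, β i * R (ε * d i)) =o[𝓝[>] (0 : ℝ)] fun ε => ε ^ s :=
    hsum.trans_isLittleO
      ((Asymptotics.isLittleO_pow_pow (Nat.lt_succ_self s)).mono nhdsWithin_le_nhds)
  have hlim := hlo.tendsto_div_nhds_zero.const_add (taylorCoeff f s * ∑ i, β i * d i ^ s)
  rw [add_zero] at hlim
  refine hlim.congr' ?_
  filter_upwards [self_mem_nhdsWithin] with ε hε
  have hε' : ε ^ s ≠ 0 := pow_ne_zero _ (ne_of_gt hε)
  have key : ∑ i, β i * R (ε * d i) =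
      ∑ i, β i * f (ε * d i) - (taylorCoeff f s * ∑ i, β i * d i ^ s) * ε ^ s := by
    have h1 : ∑ i, β i * ∑ k ∈ Finset.range (s + 1), taylorCoeff f k * (ε * d i) ^ k
        = (taylorCoeff f s * ∑ i, β i * d i ^ s) * ε ^ s := by
      have h2 : ∑ i, β i * ∑ k ∈ Finset.range (s + 1), taylorCoeff f k * (ε * d i) ^ k
          = ∑ k ∈ Finset.range (s + 1), (taylorCoeff f k * ∑ i, β i * d i ^ k) * ε ^ k := by
        simp_rw [Finset.mul_sum, Finset.sum_mul]
        rw [Finset.sum_comm]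
        refine Finset.sum_congr rfl fun k _ => Finset.sum_congr rfl fun i _ => ?_
        ring
      rw [h2, Finset.sum_range_succ, Finset.sum_eq_zero, zero_add]
      intro k hk
      rw [h k (Finset.mem_range.mp hk), zero_mul]
    rw [← h1, ← Finset.sum_sub_distrib]
    refine Finset.sum_congr rfl fun i _ => ?_
    rw [hR]
    ring
  rw [key]
  field_simp
  ring

/-! ### Inverse Vandermonde rows as dual functionals. -/

section Vandermonde

variable {m : ℕ} {z : Fin m → ℝ}

lemma sum_inv_vandermonde_mul_pow (hz : Function.Injective z) (i : Fin m) {l : ℕ} (hl : l < m) :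
    ∑ a, (vandermonde z)⁻¹ i a * z a ^ l = if (i : ℕ) = l then 1 else 0 := by
  have hdet : IsUnit (vandermonde z).det := (det_vandermonde_ne_zero_iff.mpr hz).isUnit
  have h := congrFun (congrFun (nonsing_inv_mul _ hdet) i) ⟨l, hl⟩
  rw [mul_apply] at h
  simp only [vandermonde_apply, one_apply, Fin.ext_iff] at h
  exact h

/-- For even k the absolute value disappears and the binomial theorem applies. The term z_p^l
z_q^(k-l) needs l ≥ i and k - l ≥ j to survive, which with k ≤ i + j forces l = i and k = i + j. -/
lemma sum_inv_vandermonde_dist_pow (hz : Function.Injective z) (i j : Fin m) {k : ℕ}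
    (hk : Even k) (hkij : k ≤ i + j) :
    ∑ p : Fin m × Fin m, ((vandermonde z)⁻¹ i p.1 * (vandermonde z)⁻¹ j p.2) *
      |z p.1 - z p.2| ^ k = if k = i + j then (-1) ^ (j : ℕ) * ((i + j : ℕ).choose i : ℝ) else 0 := by
  set T := (vandermonde z)⁻¹
  have h1 : ∑ p : Fin m × Fin m, (T i p.1 * T j p.2) * |z p.1 - z p.2| ^ k =
      ∑ l ∈ Finset.range (k + 1), ((-1) ^ (k - l) * (k.choose l : ℝ)) *
        ((∑ a, T i a * z a ^ l) * ∑ b, T j b * z b ^ (k - l)) := by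
    simp_rw [Finset.sum_mul_sum, ← Fintype.sum_prod_type', Finset.mul_sum]
    rw [Finset.sum_comm]
    refine Finset.sum_congr rfl fun p _ => ?_
    rw [hk.pow_abs, sub_eq_add_neg, add_pow, Finset.mul_sum]
    refine Finset.sum_congr rfl fun l _ => ?_
    rw [neg_pow (z p.2)]
    ring
  rw [h1]
  have hterm : ∀ l ∈ Finset.range (k + 1), l ≠ i →
      ((-1) ^ (k - l) * (k.choose l : ℝ)) *
        ((∑ a, T i a * z a ^ l) * ∑ b, T j b * z b ^ (k - l)) = 0 := by
    intro l hl hli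
    have hlk : l ≤ k := Nat.lt_succ_iff.mp (Finset.mem_range.mp hl)
    rcases lt_or_gt_of_ne hli with h | h
    · rw [sum_inv_vandermonde_mul_pow hz i (h.trans i.2), if_neg (ne_of_gt h)]
      simp
    · have : k - l < j := by omega
      rw [sum_inv_vandermonde_mul_pow hz j (this.trans j.2), if_neg (ne_of_gt this)]
      simp
  by_cases hik : (i : ℕ) ≤ k
  · rw [Finset.sum_eq_single_of_mem (i : ℕ) (Finset.mem_range.mpr (by omega)) hterm]
    have hj : k - i < m := by have := j.2; omega
    rw [sum_inv_vandermonde_mul_pow hz i i.2, sum_inv_vandermonde_mul_pow hz j hj]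
    by_cases hkk : k = i + j
    · subst hkk
      simp
    · have : ¬ (j : ℕ) = k - i := by omega
      simp [hkk, this]
  · rw [Finset.sum_eq_zero fun l hl => hterm l hl (by have := Finset.mem_range.mp hl; omega)]
    rw [if_neg (by omega)]

end Vandermonde

/-! ### Nonsingularity of the Wronskian matrix. -/

/-- The Gram matrix of the first `r` derivatives at the origin for the kernel `f(|x - y|)`. -/
noncomputable def wronskianMatrix (f : ℝ → ℝ) (r : ℕ) : Matrix (Fin r) (Fin r) ℝ :=
  Matrix.of fun i j =>
    taylorCoeff f (i + j) * ((-1) ^ (j : ℕ) * ((i + j : ℕ).choose i : ℝ))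

lemma HasSmoothnessOrder.taylorCoeff_eq_zero {f : ℝ → ℝ} {r k : ℕ} (h : HasSmoothnessOrder f r)
    (hk : Odd k) (hkr : k < 2 * r - 1) : taylorCoeff f k = 0 := by
  by_contra hne
  obtain ⟨s, rfl⟩ := hk
  have := h.2 (show s + 1 ∈ {s : ℕ | 1 ≤ s ∧ taylorCoeff f (2 * s - 1) ≠ 0} from
    ⟨by omega, by simpa [show 2 * (s + 1) - 1 = 2 * s + 1 by omega] using hne⟩)
  omega

/-- Below order s, even powers die by Vandermonde duality (k < i + j) and odd ones by the smoothness
order (k < 2r - 1). -/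
lemma tendsto_entry_div_pow {m r : ℕ} {z : Fin m → ℝ} (hz : Function.Injective z) {f : ℝ → ℝ}
    (hf : AnalyticAt ℝ f 0) (hr : HasSmoothnessOrder f r) (i j : Fin m) {s : ℕ}
    (hs : s ≤ i + j) (hsr : s ≤ 2 * r - 1) :
    Tendsto (fun ε => (∑ p : Fin m × Fin m, ((vandermonde z)⁻¹ i p.1 * (vandermonde z)⁻¹ j p.2) *
        f (ε * |z p.1 - z p.2|)) / ε ^ s) (𝓝[>] (0 : ℝ))
      (𝓝 (taylorCoeff f s * ∑ p : Fin m × Fin m,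
        ((vandermonde z)⁻¹ i p.1 * (vandermonde z)⁻¹ j p.2) * |z p.1 - z p.2| ^ s)) := by
  refine tendsto_sum_scaled_div_pow hf (ι := Fin m × Fin m) _ _ s fun k hk => ?_
  rcases Nat.even_or_odd k with h | h
  · rw [sum_inv_vandermonde_dist_pow hz i j h (by omega), if_neg (by omega), mul_zero]
  · rw [hr.taylorCoeff_eq_zero h (by omega), zero_mul]

lemma taylorCoeff_mul_sum_eq {m r : ℕ} {z : Fin m → ℝ} (hz : Function.Injective z) {f : ℝ → ℝ}
    (hr : HasSmoothnessOrder f r) (i j : Fin m) {s : ℕ} (hs : s ≤ i + j) (hsr : s < 2 * r - 1) :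
    taylorCoeff f s * ∑ p : Fin m × Fin m,
        ((vandermonde z)⁻¹ i p.1 * (vandermonde z)⁻¹ j p.2) * |z p.1 - z p.2| ^ s =
      if s = i + j then taylorCoeff f s * ((-1) ^ (j : ℕ) * ((i + j : ℕ).choose i : ℝ)) else 0 := by
  rcases Nat.even_or_odd s with h | h
  · rw [sum_inv_vandermonde_dist_pow hz i j h hs, mul_ite, mul_zero]
  · rw [hr.taylorCoeff_eq_zero h hsr]
    simp

/-- The combination is analytic at 0, so vanishing on one side extends to a full neighbourhood,
where it can be differentiated l times. -/
lemma sum_mul_iteratedDeriv_eq_zero {f : ℝ → ℝ} (hf : AnalyticAt ℝ f 0) {r : ℕ} (b : Fin r → ℝ)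
    (h : ∀ᶠ t in 𝓝[>] (0 : ℝ), ∑ k, b k * iteratedDeriv k f t = 0) (l : ℕ) :
    ∑ k, b k * iteratedDeriv (k + l) f 0 = 0 := by
  have han : ∀ k, AnalyticAt ℝ (iteratedDeriv k f) 0 := fun k => by
    rw [iteratedDeriv_eq_iterate]
    exact hf.iterated_deriv k
  have hφ : AnalyticAt ℝ (fun t => ∑ k, b k * iteratedDeriv k f t) 0 :=
    Finset.analyticAt_fun_sum _ fun k _ => analyticAt_const.mul (han k)
  have hfreq : ∃ᶠ t in 𝓝[≠] (0 : ℝ), ∑ k, b k * iteratedDeriv k f t = 0 :=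
    h.frequently.filter_mono (nhdsWithin_mono _ fun t ht => ne_of_gt ht)
  have hev := hφ.frequently_zero_iff_eventually_zero.mp hfreq
  have hev' : (fun t => ∑ k, b k * iteratedDeriv k f t) =ᶠ[𝓝 0] fun _ => (0 : ℝ) := hev
  have h1 := hev'.iteratedDeriv_eq l
  rw [iteratedDeriv_fun_sum (f := fun k : Fin r => fun t => b k * iteratedDeriv k f t)
    (fun k _ => (analyticAt_const.mul (han k)).contDiffAt)] at h1
  have h0 : iteratedDeriv l (fun _ : ℝ => (0 : ℝ)) 0 = 0 := by
    simp
  rw [h0] at h1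
  refine (Finset.sum_congr rfl fun k _ => ?_).trans h1
  rw [iteratedDeriv_const_mul_field]
  congr 1
  simp only [iteratedDeriv_eq_iterate]
  rw [← Function.iterate_add_apply, add_comm]

/-- Let d be the largest index with a_d ≠ 0. Combining the two relations keeps only k ≡ d mod 2.
Differentiating 2r - 1 - d times turns the top term into a multiple of the (2r-1)-st derivative,
while the terms k < d carry odd derivatives of lower order, which vanish. -/
lemma eq_zero_of_sum_mul_iteratedDeriv {f : ℝ → ℝ} {r : ℕ} (hr : HasSmoothnessOrder f r)
    (a : Fin r → ℝ)
    (h1 : ∀ l, ∑ k : Fin r, a k / (k : ℕ).factorial * iteratedDeriv (k + l) f 0 = 0)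
    (h2 : ∀ l, ∑ k : Fin r, (-1) ^ (k : ℕ) * a k / (k : ℕ).factorial *
      iteratedDeriv (k + l) f 0 = 0) : a = 0 := by
  by_contra hne
  obtain ⟨d, hd, hmax⟩ := Finset.exists_max_image (Finset.univ.filter fun k => a k ≠ 0)
    (fun k : Fin r => (k : ℕ)) (by
      obtain ⟨k, hk⟩ := Function.ne_iff.mp hne
      exact ⟨k, by simpa using hk⟩)
  have had : a d ≠ 0 := by simpa using hd
  have hdr := d.2
  have hsum : ∑ k : Fin r, (1 + (-1) ^ ((d : ℕ) + k)) * (a k / (k : ℕ).factorial) *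
      iteratedDeriv (k + (2 * r - 1 - d)) f 0 = 0 := by
    have h3 := h1 (2 * r - 1 - d)
    have h4 := congrArg (fun t => (-1) ^ (d : ℕ) * t) (h2 (2 * r - 1 - d))
    simp only [mul_zero, Finset.mul_sum] at h4
    rw [← add_zero (0 : ℝ)]
    refine Eq.trans ?_ (congrArg₂ (· + ·) h3 h4)
    rw [← Finset.sum_add_distrib]
    refine Finset.sum_congr rfl fun k _ => ?_
    rw [pow_add]
    ring_nf
  rw [Finset.sum_eq_single d] at hsum
  · have hodd : (d : ℕ) + (2 * r - 1 - d) = 2 * r - 1 := by omega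
    rw [hodd, Even.neg_one_pow (Even.add_self _)] at hsum
    have hder : iteratedDeriv (2 * r - 1) f 0 ≠ 0 := by
      have := hr.1.2
      rw [taylorCoeff] at this
      exact fun h => this (by rw [h, zero_div])
    have : (a d / (d : ℕ).factorial) ≠ 0 := div_ne_zero had (by positivity)
    simp [hder, this] at hsum
  · intro k _ hkd
    rcases lt_or_gt_of_ne (fun h => hkd (Fin.ext h) : (k : ℕ) ≠ d) with hlt | hgt
    · rcases Nat.even_or_odd ((d : ℕ) + k) with he | ho
      · have hod : Odd ((k : ℕ) + (2 * r - 1 - d)) := by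
          rw [Nat.odd_iff]
          rw [Nat.even_iff] at he
          omega
        have := hr.taylorCoeff_eq_zero hod (by omega)
        rw [taylorCoeff, div_eq_zero_iff] at this
        rw [this.resolve_right (by positivity), mul_zero]
      · rw [ho.neg_one_pow]
        simp
    · have hak : a k = 0 := by
        by_contra hk
        exact absurd (hmax k (by simpa using hk)) (not_le.mpr hgt)
      simp [hak]
  · simp

/-- The functional with moments `a k * ε ^ (-k)` supported on the points `ε * z i`. -/
noncomputable def derivWeights {r : ℕ} (z a : Fin r → ℝ) (ε : ℝ) (i : Fin r) : ℝ :=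
  ∑ k : Fin r, a k / ε ^ (k : ℕ) * (vandermonde z)⁻¹ k i

lemma tendsto_sum_derivWeights_mul {r : ℕ} {z : Fin r → ℝ} (hz : Function.Injective z)
    (a : Fin r → ℝ) {g : ℝ → ℝ} (hg : AnalyticAt ℝ g 0) :
    Tendsto (fun ε => ∑ i, derivWeights z a ε i * g (ε * z i)) (𝓝[>] (0 : ℝ))
      (𝓝 (∑ k : Fin r, a k * taylorCoeff g k)) := by
  have h : ∀ k : Fin r, Tendsto
      (fun ε => (∑ i, (vandermonde z)⁻¹ k i * g (ε * z i)) / ε ^ (k : ℕ)) (𝓝[>] (0 : ℝ))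
      (𝓝 (taylorCoeff g k)) := by
    intro k
    have := tendsto_sum_scaled_div_pow hg (fun i => (vandermonde z)⁻¹ k i) z k (fun l hl => by
      rw [sum_inv_vandermonde_mul_pow hz k (hl.trans k.2), if_neg (ne_of_gt hl), mul_zero])
    rwa [sum_inv_vandermonde_mul_pow hz k k.2, if_pos rfl, mul_one] at this
  refine (tendsto_finsetSum Finset.univ fun k _ => (h k).const_mul (a k)).congr fun ε => ?_
  simp_rw [derivWeights, Finset.sum_mul]
  rw [Finset.sum_comm]
  refine Finset.sum_congr rfl fun k _ => ?_
  rw [mul_div_assoc', Finset.mul_sum, Finset.sum_div]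
  exact Finset.sum_congr rfl fun i _ => by ring

lemma IsPosDefKernel.sum_nonneg {κ : ℝ → ℝ → ℝ} (hκ : IsPosDefKernel κ) {N : ℕ}
    (y c : Fin N → ℝ) : 0 ≤ ∑ i, ∑ j, c i * c j * κ (y i) (y j) := by
  have := (hκ N y).dotProduct_mulVec_nonneg c
  refine this.trans_eq ?_
  simp only [dotProduct, mulVec, Finset.mul_sum, star_trivial, of_apply]
  exact Finset.sum_congr rfl fun i _ => Finset.sum_congr rfl fun j _ => by ring

/-- Adjoining a point t with free weight s gives a quadratic in s, the form in which Cauchy–Schwarz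
is used below. -/
lemma IsPosDefKernel.sum_cons_nonneg {κ : ℝ → ℝ → ℝ} (hκ : IsPosDefKernel κ)
    (hsymm : ∀ x y, κ x y = κ y x) {N : ℕ} (y c : Fin N → ℝ) (t s : ℝ) :
    0 ≤ s ^ 2 * κ t t + 2 * s * ∑ i, c i * κ (y i) t + ∑ i, ∑ j, c i * c j * κ (y i) (y j) := by
  have h := hκ.sum_nonneg (Fin.cons t y : Fin (N + 1) → ℝ) (Fin.cons s c)
  simp only [Fin.sum_univ_succ, Fin.cons_zero, Fin.cons_succ, Finset.sum_add_distrib] at h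
  have h1 : ∑ i, s * c i * κ t (y i) = s * ∑ i, c i * κ (y i) t := by
    rw [Finset.mul_sum]
    exact Finset.sum_congr rfl fun i _ => by rw [hsymm t]; ring
  have h2 : ∑ i, c i * s * κ (y i) t = s * ∑ i, c i * κ (y i) t := by
    rw [Finset.mul_sum]
    exact Finset.sum_congr rfl fun i _ => by ring
  rw [h1, h2] at h
  linarith

lemma IsStationaryKernel.scaled_eq {κ : ℝ → ℝ → ℝ} {f : ℝ → ℝ} (h : IsStationaryKernel κ f)
    {ε : ℝ} (hε : 0 < ε) (x y : ℝ) : κ (ε * x) (ε * y) = f (ε * |x - y|) := by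
  rw [h.eq_profile, ← mul_sub, abs_mul, abs_of_pos hε]

/-- The weights `derivWeights` approximate the functional g ↦ ∑ a_k g_k at 0. Their energy tends to
aᵀ W a = 0, so by Cauchy–Schwarz their action on the section κ(·, t) tends to 0 as well. -/
lemma sum_mul_taylorCoeff_eq_zero {κ : ℝ → ℝ → ℝ} {f : ℝ → ℝ} {r : ℕ}
    (hκ : IsStationaryKernel κ f) (hr : HasSmoothnessOrder f r) {a : Fin r → ℝ}
    (ha : wronskianMatrix f r *ᵥ a = 0) {z : Fin r → ℝ} (hz : Function.Injective z)
    {g : ℝ → ℝ} (hg : AnalyticAt ℝ g 0) (t : ℝ)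
    (ht : ∀ i, ∀ᶠ ε in 𝓝[>] (0 : ℝ), κ (ε * z i) t = g (ε * z i)) :
    ∑ k : Fin r, a k * taylorCoeff g k = 0 := by
  have hquad : Tendsto (fun ε => ∑ i, ∑ j, derivWeights z a ε i * derivWeights z a ε j *
      κ (ε * z i) (ε * z j)) (𝓝[>] (0 : ℝ)) (𝓝 0) := by
    have h1 : ∀ k l : Fin r, Tendsto (fun ε => a k * a l *
        ((∑ p : Fin r × Fin r, ((vandermonde z)⁻¹ k p.1 * (vandermonde z)⁻¹ l p.2) *
        f (ε * |z p.1 - z p.2|)) / ε ^ ((k : ℕ) + l))) (𝓝[>] (0 : ℝ))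
        (𝓝 (a k * a l * wronskianMatrix f r k l)) := by
      intro k l
      have hk := k.2
      have hl := l.2
      have := tendsto_entry_div_pow hz hκ.analyticAt_zero hr k l le_rfl (by omega)
      rw [taylorCoeff_mul_sum_eq hz hr k l le_rfl (by omega), if_pos rfl] at this
      exact this.const_mul _
    have h2 := tendsto_finsetSum Finset.univ fun k _ =>
      tendsto_finsetSum Finset.univ fun l _ => h1 k l
    have h3 : ∑ k, ∑ l, a k * a l * wronskianMatrix f r k l = 0 := by
      have : ∀ k, ∑ l, a k * a l * wronskianMatrix f r k l = a k * (wronskianMatrix f r *ᵥ a) k := by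
        intro k
        rw [mulVec, dotProduct, Finset.mul_sum]
        exact Finset.sum_congr rfl fun l _ => by ring
      simp [this, ha]
    rw [h3] at h2
    refine h2.congr' ?_
    filter_upwards [self_mem_nhdsWithin] with ε hε
    simp_rw [hκ.scaled_eq hε, derivWeights, Finset.sum_mul_sum, Fintype.sum_prod_type,
      Finset.sum_div, Finset.mul_sum, Finset.sum_mul]
    calc _ = ∑ k, ∑ i, ∑ l, ∑ j, _ := Finset.sum_congr rfl fun k _ => Finset.sum_comm
      _ = ∑ i, ∑ k, ∑ l, ∑ j, _ := Finset.sum_comm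
      _ = ∑ i, ∑ k, ∑ j, ∑ l, _ :=
        Finset.sum_congr rfl fun i _ => Finset.sum_congr rfl fun k _ => Finset.sum_comm
      _ = ∑ i, ∑ j, ∑ k, ∑ l, _ := Finset.sum_congr rfl fun i _ => Finset.sum_comm
      _ = _ := by
        refine Finset.sum_congr rfl fun i _ => Finset.sum_congr rfl fun j _ =>
          Finset.sum_congr rfl fun k _ => Finset.sum_congr rfl fun l _ => ?_
        rw [pow_add]
        ring
  set φ := ∑ k : Fin r, a k * taylorCoeff g k with hφ
  have hlin : Tendsto (fun ε => ∑ i, derivWeights z a ε i * κ (ε * z i) t) (𝓝[>] (0 : ℝ))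
      (𝓝 φ) := by
    refine (tendsto_sum_derivWeights_mul hz a hg).congr' ?_
    filter_upwards [eventually_all.mpr ht] with ε hε
    exact Finset.sum_congr rfl fun i _ => by rw [hε i]
  have hs : ∀ s : ℝ, 0 ≤ s ^ 2 * κ t t + 2 * s * φ := by
    intro s
    have hl := ((hlin.const_mul (2 * s)).const_add (s ^ 2 * κ t t)).add hquad
    rw [add_zero] at hl
    exact ge_of_tendsto' hl fun ε => hκ.posDef.sum_cons_nonneg
      (fun x y => by rw [hκ.eq_profile, hκ.eq_profile, abs_sub_comm]) _ _ t s
  have hc : 0 ≤ κ t t := by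
    have h1 := hs 1
    have h2 := hs (-1)
    linarith
  -- Near the minimiser of the quadratic; the added 1 avoids dividing by a zero κ(t, t).
  have h := hs (-φ / (κ t t + 1))
  have hpos : 0 < κ t t + 1 := by linarith
  have heq : (-φ / (κ t t + 1)) ^ 2 * κ t t + 2 * (-φ / (κ t t + 1)) * φ
      = -(φ ^ 2 * (κ t t + 2)) / (κ t t + 1) ^ 2 := by
    field_simp
    ring
  rw [heq, neg_div, Left.nonneg_neg_iff, div_le_iff₀ (by positivity), zero_mul] at h
  have : φ ^ 2 = 0 := by nlinarith [sq_nonneg φ]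
  exact pow_eq_zero_iff (two_ne_zero) |>.mp this

/-- For a kernel of finite smoothness order `r`, the Wronskian matrix of size `r` is
invertible. -/
theorem det_wronskianMatrix_ne_zero {κ : ℝ → ℝ → ℝ} {f : ℝ → ℝ} {r : ℕ}
    (hκ : IsStationaryKernel κ f) (hr : HasSmoothnessOrder f r) :
    (wronskianMatrix f r).det ≠ 0 := by
  intro hdet
  obtain ⟨a, ha0, ha⟩ := exists_mulVec_eq_zero_iff.mpr hdet
  have hz : Function.Injective fun i : Fin r => ((i : ℕ) : ℝ) := fun i j h =>
    Fin.ext (Nat.cast_injective h)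
  have hsmall : ∀ (i : Fin r) {τ : ℝ}, 0 < τ →
      ∀ᶠ ε in 𝓝[>] (0 : ℝ), 0 < ε ∧ ε * ((i : ℕ) : ℝ) < τ := by
    intro i τ hτ
    have ht : Tendsto (fun ε : ℝ => ε * ((i : ℕ) : ℝ)) (𝓝[>] (0 : ℝ)) (𝓝 (0 * ((i : ℕ) : ℝ))) :=
      ((continuous_id.mul continuous_const).tendsto 0).mono_left nhdsWithin_le_nhds
    rw [zero_mul] at ht
    exact (eventually_mem_nhdsWithin (a := (0 : ℝ)) (s := Set.Ioi 0)).and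
      (ht.eventually_lt_const hτ)
  have han : ∀ᶠ τ in 𝓝[>] (0 : ℝ), AnalyticAt ℝ f τ :=
    nhdsWithin_le_nhds hκ.analyticAt_zero.eventually_analyticAt
  refine ha0 (eq_zero_of_sum_mul_iteratedDeriv hr a
    (sum_mul_iteratedDeriv_eq_zero hκ.analyticAt_zero _ ?_)
    (sum_mul_iteratedDeriv_eq_zero hκ.analyticAt_zero _ ?_))
  · filter_upwards [han, self_mem_nhdsWithin] with τ hfτ hτ
    have hτ' : (0 : ℝ) < τ := hτ
    have hg : AnalyticAt ℝ (fun u => f (τ + u)) 0 :=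
      AnalyticAt.fun_comp (by simpa using hfτ) (by fun_prop)
    -- All nodes ε i lie to the right of -τ, so the section is f(τ + u). Below, for t = τ, they lie
    -- to the left and the section f(τ - u) yields the alternating signs.
    have := sum_mul_taylorCoeff_eq_zero hκ hr ha hz hg (-τ) fun i => by
      filter_upwards [hsmall i hτ'] with ε hε
      have hnn := mul_nonneg hε.1.le (Nat.cast_nonneg (α := ℝ) i)
      rw [hκ.eq_profile, abs_of_nonneg (by linarith)]
      congr 1
      ring
    rw [← this]
    refine Finset.sum_congr rfl fun k _ => ?_
    rw [taylorCoeff, iteratedDeriv_comp_const_add]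
    simp only [add_zero]
    ring
  · filter_upwards [han, self_mem_nhdsWithin] with τ hfτ hτ
    have hτ' : (0 : ℝ) < τ := hτ
    have hg : AnalyticAt ℝ (fun u => f (τ - u)) 0 :=
      AnalyticAt.fun_comp (by simpa using hfτ) (by fun_prop)
    have := sum_mul_taylorCoeff_eq_zero hκ hr ha hz hg τ fun i => by
      filter_upwards [hsmall i hτ'] with ε hε
      rw [hκ.eq_profile, abs_sub_comm, abs_of_nonneg (by linarith [hε.2])]
    rw [← this]
    refine Finset.sum_congr rfl fun k _ => ?_
    rw [taylorCoeff, iteratedDeriv_comp_const_sub]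
    simp only [sub_zero, smul_eq_mul]
    ring

/-! ### Conditional positivity of odd distance powers. -/

section ConditionalPositivity

open MeasureTheory

/-- The difference is an integral from y to x; substituting t = (x - y)s + y turns it into a Beta
integral. -/
lemma integral_pow_mul_pow_sub (A x y : ℝ) (p : ℕ) :
    (∫ t in A..x, (x - t) ^ p * (y - t) ^ p) - ∫ t in A..y, (y - t) ^ p * (x - t) ^ p =
      (-1) ^ p * (x - y) ^ (2 * p + 1) * ∫ s in (0 : ℝ)..1, (1 - s) ^ p * s ^ p := by
  have hii : ∀ a b : ℝ, IntervalIntegrable (fun t => (x - t) ^ p * (y - t) ^ p) volume a b :=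
    fun a b => Continuous.intervalIntegrable (by fun_prop) a b
  have h1 : (∫ t in A..x, (x - t) ^ p * (y - t) ^ p) - ∫ t in A..y, (y - t) ^ p * (x - t) ^ p =
      ∫ t in y..x, (x - t) ^ p * (y - t) ^ p := by
    simp_rw [mul_comm ((y - _) ^ p)]
    exact intervalIntegral.integral_interval_sub_left (hii _ _) (hii _ _)
  have h2 := intervalIntegral.mul_integral_comp_mul_add (a := 0) (b := 1)
    (f := fun t => (x - t) ^ p * (y - t) ^ p) (x - y) y
  rw [mul_zero, zero_add, mul_one, sub_add_cancel] at h2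
  rw [h1, ← h2, ← intervalIntegral.integral_const_mul, ← intervalIntegral.integral_const_mul]
  refine intervalIntegral.integral_congr fun s _ => ?_
  have e1 : x - ((x - y) * s + y) = (x - y) * (1 - s) := by ring
  have e2 : y - ((x - y) * s + y) = (-1) * ((x - y) * s) := by ring
  simp only [e1, e2, mul_pow]
  ring

/-- The integral up to the minimum is the half-sum of the two integrals minus half their absolute
difference, up to the sign (-1)^p. -/
lemma integral_min_pow_mul_pow (A x y : ℝ) (p : ℕ) :
    ∫ t in A..min x y, (x - t) ^ p * (y - t) ^ p =
      ((∫ t in A..x, (x - t) ^ p * (y - t) ^ p) +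
        ∫ t in A..y, (y - t) ^ p * (x - t) ^ p) / 2 +
      (-1) ^ (p + 1) * |x - y| ^ (2 * p + 1) *
        ((∫ s in (0 : ℝ)..1, (1 - s) ^ p * s ^ p) / 2) := by
  have h := integral_pow_mul_pow_sub A x y p
  have hodd : Odd (2 * p + 1) := ⟨p, rfl⟩
  rcases le_total x y with hxy | hxy
  · rw [min_eq_left hxy, abs_of_nonpos (by linarith), hodd.neg_pow, pow_succ (-1 : ℝ) p]
    linarith
  · rw [min_eq_right hxy, abs_of_nonneg (by linarith), pow_succ (-1 : ℝ) p]
    simp_rw [mul_comm ((x - _) ^ p)] at h ⊢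
    linarith

lemma integral_beta_pos (p : ℕ) : 0 < ∫ s in (0 : ℝ)..1, (1 - s) ^ p * s ^ p := by
  refine intervalIntegral.intervalIntegral_pos_of_pos_on
    (Continuous.intervalIntegrable (by fun_prop) _ _) (fun s hs => ?_) one_pos
  have h1 : 0 < 1 - s := by linarith [hs.2]
  have h2 : 0 < s := hs.1
  positivity

variable {N : ℕ}

lemma sum_mul_sub_pow_eq_zero {x c : Fin N → ℝ} {p : ℕ}
    (hc : ∀ k ≤ p, ∑ i, c i * x i ^ k = 0) (t : ℝ) : ∑ i, c i * (x i - t) ^ p = 0 := by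
  simp_rw [sub_eq_add_neg, add_pow, Finset.mul_sum]
  rw [Finset.sum_comm]
  refine Finset.sum_eq_zero fun k hk => ?_
  have h := hc k (Nat.lt_succ_iff.mp (Finset.mem_range.mp hk))
  calc _ = (∑ i, c i * x i ^ k) * ((-t) ^ (p - k) * (p.choose k : ℝ)) := by
        rw [Finset.sum_mul]
        exact Finset.sum_congr rfl fun i _ => by ring
    _ = 0 := by rw [h, zero_mul]

lemma sum_mul_integral_eq_zero {x c : Fin N → ℝ} {p : ℕ}
    (hc : ∀ k ≤ p, ∑ i, c i * x i ^ k = 0) (A : ℝ) (y : ℝ) :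
    ∑ j, c j * ∫ t in A..y, (y - t) ^ p * (x j - t) ^ p = 0 := by
  simp_rw [← intervalIntegral.integral_const_mul]
  rw [← intervalIntegral.integral_finsetSum
    fun j _ => Continuous.intervalIntegrable (by fun_prop) _ _]
  have : ∀ t, ∑ j, c j * ((y - t) ^ p * (x j - t) ^ p) = 0 := fun t => by
    calc _ = (y - t) ^ p * ∑ j, c j * (x j - t) ^ p := by
          rw [Finset.mul_sum]
          exact Finset.sum_congr rfl fun j _ => by ring
      _ = 0 := by rw [sum_mul_sub_pow_eq_zero hc, mul_zero]
  simp [this]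

/-- In each half-sum term the endpoint depends on one index only, so summing over the other index
kills it by the moment conditions. -/
lemma sum_integral_min_eq {x c : Fin N → ℝ} {p : ℕ}
    (hc : ∀ k ≤ p, ∑ i, c i * x i ^ k = 0) (A : ℝ) :
    ∑ i, ∑ j, c i * c j * ∫ t in A..min (x i) (x j), (x i - t) ^ p * (x j - t) ^ p =
      ((∫ s in (0 : ℝ)..1, (1 - s) ^ p * s ^ p) / 2) *
        ((-1) ^ (p + 1) * ∑ i, ∑ j, c i * c j * |x i - x j| ^ (2 * p + 1)) := by
  have h1 : ∑ i, ∑ j, c i * c j * ∫ t in A..x i, (x i - t) ^ p * (x j - t) ^ p = 0 := by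
    refine Finset.sum_eq_zero fun i _ => ?_
    simp_rw [mul_assoc]
    rw [← Finset.mul_sum, sum_mul_integral_eq_zero hc, mul_zero]
  have h2 : ∑ i, ∑ j, c i * c j * ∫ t in A..x j, (x j - t) ^ p * (x i - t) ^ p = 0 := by
    rw [Finset.sum_comm, ← h1]
    exact Finset.sum_congr rfl fun i _ => Finset.sum_congr rfl fun j _ => by ring
  simp_rw [integral_min_pow_mul_pow, mul_add, Finset.sum_add_distrib, add_div, mul_add,
    Finset.sum_add_distrib, mul_div_assoc', ← Finset.sum_div]
  rw [h1, h2, Finset.mul_sum, Finset.mul_sum]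
  simp_rw [Finset.mul_sum, Finset.sum_div]
  rw [zero_div, zero_add, zero_add]
  exact Finset.sum_congr rfl fun i _ => Finset.sum_congr rfl fun j _ => by ring

/-- The one-sided truncated power `(x - t)_+^p`, cut off at `A` on the left. -/
noncomputable def truncPow (A : ℝ) (p : ℕ) (x : ℝ) : ℝ → ℝ :=
  (Set.Ioc A x).indicator fun t => (x - t) ^ p

lemma truncPow_mul (A : ℝ) (p : ℕ) (x y : ℝ) :
    (fun t => truncPow A p x t * truncPow A p y t) =
      (Set.Ioc A (min x y)).indicator fun t => (x - t) ^ p * (y - t) ^ p := by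
  funext t
  rw [truncPow, truncPow, ← Set.inter_indicator_mul, Set.Ioc_inter_Ioc, max_self]

lemma integrable_truncPow_mul (A : ℝ) (p : ℕ) (x y : ℝ) :
    Integrable fun t => truncPow A p x t * truncPow A p y t := by
  rw [truncPow_mul, integrable_indicator_iff measurableSet_Ioc]
  exact (Continuous.integrableOn_Icc (by fun_prop)).mono_set Set.Ioc_subset_Icc_self

lemma integral_truncPow_mul {A : ℝ} (p : ℕ) {x y : ℝ} (hx : A ≤ x) (hy : A ≤ y) :
    ∫ t, truncPow A p x t * truncPow A p y t =
      ∫ t in A..min x y, (x - t) ^ p * (y - t) ^ p := by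
  rw [truncPow_mul, integral_indicator measurableSet_Ioc,
    intervalIntegral.integral_of_le (le_min hx hy)]

/-- The integrand is a square. Just to the left of the largest node with nonzero weight only that
node contributes, so the square is positive on an interval. -/
lemma integral_sum_truncPow_sq_pos {x c : Fin N → ℝ} (hx : Function.Injective x) (hc0 : c ≠ 0)
    (p : ℕ) {A : ℝ} (hA : ∀ i, A < x i) :
    0 < ∫ t, ∑ i, ∑ j, c i * c j * (truncPow A p (x i) t * truncPow A p (x j) t) := by
  have hsq : ∀ t, ∑ i, ∑ j, c i * c j * (truncPow A p (x i) t * truncPow A p (x j) t) =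
      (∑ i, c i * truncPow A p (x i) t) ^ 2 := fun t => by
    rw [sq, Finset.sum_mul_sum]
    exact Finset.sum_congr rfl fun i _ => Finset.sum_congr rfl fun j _ => by ring
  have hint : Integrable fun t =>
      ∑ i, ∑ j, c i * c j * (truncPow A p (x i) t * truncPow A p (x j) t) :=
    integrable_finsetSum _ fun i _ => integrable_finsetSum _ fun j _ =>
      (integrable_truncPow_mul A p (x i) (x j)).const_mul _
  rw [integral_pos_iff_support_of_nonneg (fun t => by rw [hsq]; positivity) hint]
  obtain ⟨d, hd, hmax⟩ := Finset.exists_max_image (Finset.univ.filter fun k => c k ≠ 0) x (by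
    obtain ⟨k, hk⟩ := Function.ne_iff.mp hc0
    exact ⟨k, by simpa using hk⟩)
  have hcd : c d ≠ 0 := by simpa using hd
  have hlt : ∀ i, i ≠ d → c i ≠ 0 → x i < x d := fun i hi hci =>
    lt_of_le_of_ne (hmax i (by simpa using hci)) fun h => hi (hx h)
  have hev : ∀ᶠ t in 𝓝[<] x d, A < t ∧ t < x d ∧ ∀ i, i ≠ d → c i ≠ 0 → x i < t := by
    refine (eventually_nhdsWithin_of_eventually_nhds (eventually_gt_nhds (hA d))).and
      (eventually_mem_nhdsWithin.and (eventually_all.mpr fun i => ?_))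
    by_cases h : i ≠ d ∧ c i ≠ 0
    · filter_upwards [eventually_nhdsWithin_of_eventually_nhds
        (eventually_gt_nhds (hlt i h.1 h.2))] with t ht _ _ using ht
    · exact Eventually.of_forall fun t h1 h2 => absurd ⟨h1, h2⟩ h
  obtain ⟨u, hu, hsub⟩ := (mem_nhdsLT_iff_exists_Ioo_subset' (hA d)).mp hev
  refine lt_of_lt_of_le ?_ (measure_mono (s := Set.Ioo u (x d)) fun t ht => ?_)
  · have hu' : u < x d := hu
    simpa using hu'
  · obtain ⟨h1, h2, h3⟩ := hsub ht
    rw [Function.mem_support, hsq, Finset.sum_eq_single d]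
    · rw [truncPow, Set.indicator_of_mem (show t ∈ Set.Ioc A (x d) from ⟨h1, h2.le⟩)]
      exact pow_ne_zero _ (mul_ne_zero hcd (pow_ne_zero _ (by linarith)))
    · intro i _ hid
      by_cases hci : c i = 0
      · rw [hci, zero_mul]
      · rw [truncPow, Set.indicator_of_notMem (fun h => absurd h.2 (not_le.mpr (h3 i hid hci))),
          mul_zero]
    · simp

/-- The kernel `(-1)^r |x - y|^(2r-1)` is strictly conditionally positive definite with respect to
polynomials of degree less than `r`. -/
theorem sum_dist_pow_pos {x c : Fin N → ℝ} (hx : Function.Injective x) (hc0 : c ≠ 0) {r : ℕ}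
    (hr : 1 ≤ r) (hc : ∀ k < r, ∑ i, c i * x i ^ k = 0) :
    0 < (-1) ^ r * ∑ i, ∑ j, c i * c j * |x i - x j| ^ (2 * r - 1) := by
  obtain ⟨p, rfl⟩ : ∃ p, r = p + 1 := ⟨r - 1, by omega⟩
  obtain ⟨A₀, hA₀⟩ := (Set.finite_range x).bddBelow
  have hA : ∀ i, A₀ - 1 < x i := fun i => by linarith [hA₀ (Set.mem_range_self i)]
  have hpos := integral_sum_truncPow_sq_pos hx hc0 p hA
  rw [integral_finsetSum _ fun i _ => integrable_finsetSum _ fun j _ =>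
      (integrable_truncPow_mul _ p (x i) (x j)).const_mul _] at hpos
  simp_rw [integral_finsetSum _ fun j _ =>
      (integrable_truncPow_mul _ p (x _) (x j)).const_mul _, integral_const_mul,
    integral_truncPow_mul p (hA _).le (hA _).le] at hpos
  rw [sum_integral_min_eq (fun k hk => hc k (Nat.lt_succ_of_le hk))] at hpos
  rw [show 2 * (p + 1) - 1 = 2 * p + 1 by omega]
  exact pos_of_mul_pos_right hpos (by have := integral_beta_pos p; positivity)

end ConditionalPositivity

/-! ### Compressions, saddle-point determinants and the rescaled limit. -/

section Determinants

variable {r q : ℕ}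

/-- The rows of the inverse Vandermonde matrix that annihilate polynomials of degree `< r`. -/
noncomputable def annihilatorRows (z : Fin (r + q) → ℝ) : Matrix (Fin q) (Fin (r + q)) ℝ :=
  (vandermonde z)⁻¹.submatrix (Fin.natAdd r) id

/-- The compression of `D` to the functionals annihilating polynomials of degree `< r`. -/
noncomputable def compression (z : Fin (r + q) → ℝ) (D : Matrix (Fin (r + q)) (Fin (r + q)) ℝ) :
    Matrix (Fin q) (Fin q) ℝ :=
  annihilatorRows z * D * (annihilatorRows z)ᵀ

lemma mul_mul_transpose_apply {m k : ℕ} (S : Matrix (Fin k) (Fin m) ℝ)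
    (D : Matrix (Fin m) (Fin m) ℝ) (i j : Fin k) :
    (S * D * Sᵀ) i j = ∑ p : Fin m × Fin m, (S i p.1 * S j p.2) * D p.1 p.2 := by
  rw [Fintype.sum_prod_type_right]
  simp only [mul_apply, transpose_apply, Finset.sum_mul]
  exact Finset.sum_congr rfl fun b _ => Finset.sum_congr rfl fun a _ => by ring

lemma compression_eq_submatrix (z : Fin (r + q) → ℝ)
    (D : Matrix (Fin (r + q)) (Fin (r + q)) ℝ) :
    compression z D = ((vandermonde z)⁻¹ * D * (vandermonde z)⁻¹ᵀ).submatrix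
      (Fin.natAdd r) (Fin.natAdd r) := by
  ext i j
  rw [compression, mul_mul_transpose_apply, submatrix_apply, mul_mul_transpose_apply]
  rfl

lemma compression_smul (z : Fin (r + q) → ℝ) (a : ℝ)
    (D : Matrix (Fin (r + q)) (Fin (r + q)) ℝ) : compression z (a • D) = a • compression z D := by
  simp [compression]

lemma det_inv_vandermonde_conj {m : ℕ} {z : Fin m → ℝ} (hz : Function.Injective z)
    (D : Matrix (Fin m) (Fin m) ℝ) :
    D.det = (vandermonde z).det ^ 2 *
      ((vandermonde z)⁻¹ * D * (vandermonde z)⁻¹ᵀ).det := by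
  have hdet : (vandermonde z).det ≠ 0 := det_vandermonde_ne_zero_iff.mpr hz
  rw [det_mul, det_mul, det_transpose, det_nonsing_inv, Ring.inverse_eq_inv']
  field_simp

lemma posDef_compression {z : Fin (r + q) → ℝ} (hz : Function.Injective z) (hr : 1 ≤ r) :
    (compression z ((-1 : ℝ) ^ r • distMatrix z (2 * r - 1))).PosDef := by
  have hsymm : (distMatrix z (2 * r - 1))ᵀ = distMatrix z (2 * r - 1) := by
    ext i j
    simp [distMatrix, abs_sub_comm]
  refine PosDef.of_dotProduct_mulVec_pos ?_ fun b hb => ?_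
  · rw [IsHermitian, conjTranspose_eq_transpose_of_trivial, compression, transpose_mul,
      transpose_mul, transpose_smul, hsymm, transpose_transpose, Matrix.mul_assoc]
  set c := b ᵥ* annihilatorRows z with hc
  have hmom : ∀ k : ℕ, ∑ a, c a * z a ^ k =
      ∑ i, b i * ∑ a, (vandermonde z)⁻¹ (Fin.natAdd r i) a * z a ^ k := by
    intro k
    simp only [hc, vecMul, dotProduct, annihilatorRows, submatrix_apply, id, Finset.sum_mul,
      Finset.mul_sum]
    rw [Finset.sum_comm]
    exact Finset.sum_congr rfl fun i _ => Finset.sum_congr rfl fun a _ => by ring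
  have hc0 : c ≠ 0 := by
    intro h
    obtain ⟨i₀, hi₀⟩ := Function.ne_iff.mp hb
    apply hi₀
    -- The moment of c of order r + i₀ is exactly b i₀, so c = 0 would force b = 0.
    have h1 := hmom (r + i₀)
    rw [h, Finset.sum_eq_single i₀] at h1
    · rw [sum_inv_vandermonde_mul_pow hz _ (by have := i₀.2; omega)] at h1
      simpa using h1.symm
    · intro i _ hi
      have : ¬ (i : ℕ) = i₀ := fun h => hi (Fin.ext h)
      rw [sum_inv_vandermonde_mul_pow hz _ (by have := i₀.2; omega)]
      simp [this]
    · simp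
  have hcm : ∀ k < r, ∑ i, c i * z i ^ k = 0 := by
    intro k hk
    rw [hmom]
    refine Finset.sum_eq_zero fun i _ => ?_
    rw [sum_inv_vandermonde_mul_pow hz _ (by omega), if_neg (by simp; omega), mul_zero]
  refine (sum_dist_pow_pos hz hc0 hr hcm).trans_eq ?_
  rw [star_trivial, compression, ← mulVec_mulVec, ← mulVec_mulVec, mulVec_transpose,
    dotProduct_mulVec, ← hc, smul_mulVec, dotProduct_smul, smul_eq_mul]
  congr 1
  simp only [dotProduct, mulVec, Finset.mul_sum, distMatrix, of_apply]
  exact Finset.sum_congr rfl fun i _ => Finset.sum_congr rfl fun j _ => by ring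

/-- The matrix exchanging two blocks of size `r`. -/
def blockSwap (r : ℕ) : Matrix (Fin r ⊕ Fin r) (Fin r ⊕ Fin r) ℝ := fromBlocks 0 1 1 0

/-- The inverse of [A 1; 1 0] is [0 1; 1 -A], whose zero corner makes the Schur correction vanish:
A, B and C do not matter. -/
lemma det_fromBlocks_saddle (E : Matrix (Fin q) (Fin q) ℝ) (C : Matrix (Fin q) (Fin r) ℝ)
    (B : Matrix (Fin r) (Fin q) ℝ) (A : Matrix (Fin r) (Fin r) ℝ) :
    (fromBlocks E (fromCols C (0 : Matrix (Fin q) (Fin r) ℝ))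
      (fromRows B (0 : Matrix (Fin r) (Fin q) ℝ))
        (fromBlocks A (1 : Matrix (Fin r) (Fin r) ℝ) (1 : Matrix (Fin r) (Fin r) ℝ) 0)).det =
    (blockSwap r).det * E.det := by
  have hS : fromBlocks A 1 1 0 * fromBlocks 0 1 1 (-A) =
      (1 : Matrix (Fin r ⊕ Fin r) (Fin r ⊕ Fin r) ℝ) := by
    rw [fromBlocks_multiply]
    simp
  let _ : Invertible (fromBlocks A 1 1 (0 : Matrix (Fin r) (Fin r) ℝ)) :=
    invertibleOfRightInverse _ _ hS
  have hinv : ⅟(fromBlocks A 1 1 (0 : Matrix (Fin r) (Fin r) ℝ)) = fromBlocks 0 1 1 (-A) := rfl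
  have hdet : (fromBlocks A 1 1 (0 : Matrix (Fin r) (Fin r) ℝ)).det =
      (blockSwap r).det := by
    have : fromBlocks A 1 1 (0 : Matrix (Fin r) (Fin r) ℝ) =
        fromBlocks 1 A 0 1 * blockSwap r := by
      rw [blockSwap, fromBlocks_multiply]
      simp
    rw [this, det_mul, det_fromBlocks_zero₂₁]
    simp
  rw [det_fromBlocks₂₂, hinv, hdet, fromCols_mul_fromBlocks, fromCols_mul_fromRows]
  simp

lemma det_blockSwap_ne_zero :
    (blockSwap r).det ≠ 0 := by
  have h : blockSwap r * blockSwap r = 1 := by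
    rw [blockSwap, fromBlocks_multiply]
    simp
  have h2 := congrArg det h
  rw [det_mul, det_one] at h2
  exact left_ne_zero_of_mul_eq_one h2

/-- The first r columns of Q are Q times the first r columns of the identity. Conjugating by Q
therefore turns the constraint blocks into identity blocks, and `det_fromBlocks_saddle` applies
after reordering. -/
lemma det_fromBlocks_vandermondeLT {z : Fin (r + q) → ℝ} (hz : Function.Injective z)
    (D : Matrix (Fin (r + q)) (Fin (r + q)) ℝ) :
    (fromBlocks D (vandermondeLT z r) (vandermondeLT z r)ᵀ 0).det =
      (blockSwap r).det *
        ((vandermonde z).det ^ 2 * (compression z D).det) := by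
  have hdet : IsUnit (vandermonde z).det := (det_vandermonde_ne_zero_iff.mpr hz).isUnit
  set Q := vandermonde z with hQ
  set G := Q⁻¹ * D * Q⁻¹ᵀ with hG
  set J : Matrix (Fin (r + q)) (Fin r) ℝ := (1 : Matrix _ _ ℝ).submatrix id (Fin.castAdd q) with hJ
  have hV : vandermondeLT z r = Q * J := by
    ext i j
    simp [hJ, hQ, vandermondeLT, mul_apply, one_apply, vandermonde_apply]
  have hD : D = Q * G * Qᵀ := by
    rw [hG, Matrix.mul_assoc, Matrix.mul_assoc, ← transpose_mul, mul_nonsing_inv _ hdet,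
      transpose_one, Matrix.mul_one, ← Matrix.mul_assoc, mul_nonsing_inv _ hdet, Matrix.one_mul]
  have hfac : fromBlocks D (vandermondeLT z r) (vandermondeLT z r)ᵀ 0 =
      fromBlocks Q 0 0 (1 : Matrix (Fin r) (Fin r) ℝ) * fromBlocks G J Jᵀ 0 *
        fromBlocks Qᵀ 0 0 (1 : Matrix (Fin r) (Fin r) ℝ) := by
    rw [fromBlocks_multiply, fromBlocks_multiply, hV, transpose_mul]
    conv_lhs => rw [hD]
    simp
  have hmid : (fromBlocks G J Jᵀ (0 : Matrix (Fin r) (Fin r) ℝ)).det =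
      (blockSwap r).det * (compression z D).det := by
    let φ : Fin q ⊕ (Fin r ⊕ Fin r) ≃ Fin (r + q) ⊕ Fin r :=
      (Equiv.sumAssoc _ _ _).symm.trans
        (Equiv.sumCongr ((Equiv.sumComm _ _).trans finSumFinEquiv) (Equiv.refl _))
    rw [← det_submatrix_equiv_self φ, compression_eq_submatrix,
      ← det_fromBlocks_saddle _ (G.submatrix (Fin.natAdd r) (Fin.castAdd q))
        (G.submatrix (Fin.castAdd q) (Fin.natAdd r))
        (G.submatrix (Fin.castAdd q) (Fin.castAdd q))]
    congr 1
    have hne : ∀ (i : Fin q) (j : Fin r), Fin.natAdd r i ≠ Fin.castAdd q j := fun i j h => by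
      have h1 := congrArg Fin.val h
      have := j.2
      simp at h1
      omega
    ext (i | i | i) (j | j | j) <;>
      simp [φ, hJ, one_apply, hne, (hne _ _).symm, ← hG, ← hQ]
  rw [hfac, det_mul, det_mul, hmid, det_fromBlocks_zero₁₂, det_fromBlocks_zero₁₂, det_transpose,
    det_one]
  ring

/-- The powers of `ε` divided out of the rows of the transformed kernel matrix. -/
def rowOrder (r q : ℕ) : Fin r ⊕ Fin q → ℕ := Sum.elim (fun i => (i : ℕ)) fun _ => r

/-- The powers of `ε` divided out of the columns of the transformed kernel matrix. -/
def colOrder (r q : ℕ) : Fin r ⊕ Fin q → ℕ := Sum.elim (fun i => (i : ℕ)) fun _ => r - 1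

/-- Row exponents are capped at r and column exponents at r - 1, so that they add up to 2r - 1 in
the last block; the asymmetry keeps the powers of ε integral. -/
lemma tendsto_det_div_pow {z : Fin (r + q) → ℝ} (hz : Function.Injective z) {f : ℝ → ℝ}
    (hf : AnalyticAt ℝ f 0) (hr : HasSmoothnessOrder f r) :
    Tendsto (fun ε => (Matrix.of fun i j => f (ε * |z i - z j|)).det /
        ε ^ (∑ i, rowOrder r q i + ∑ i, colOrder r q i)) (𝓝[>] (0 : ℝ))
      (𝓝 ((vandermonde z).det ^ 2 * ((wronskianMatrix f r).det *
        (taylorCoeff f (2 * r - 1) ^ q * (compression z (distMatrix z (2 * r - 1))).det)))) := by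
  have hr1 : 1 ≤ r := hr.1.1
  set T := (vandermonde z)⁻¹ with hT
  let e : Fin r ⊕ Fin q ≃ Fin (r + q) := finSumFinEquiv
  let s : Fin r ⊕ Fin q → Fin r ⊕ Fin q → ℕ := fun i j => rowOrder r q i + colOrder r q j
  let G : ℝ → Matrix (Fin r ⊕ Fin q) (Fin r ⊕ Fin q) ℝ := fun ε => Matrix.of fun i j =>
    (∑ p : Fin (r + q) × Fin (r + q), (T (e i) p.1 * T (e j) p.2) *
      f (ε * |z p.1 - z p.2|)) / ε ^ s i j
  let M : Matrix (Fin r ⊕ Fin q) (Fin r ⊕ Fin q) ℝ := Matrix.of fun i j =>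
    taylorCoeff f (s i j) * ∑ p : Fin (r + q) × Fin (r + q), (T (e i) p.1 * T (e j) p.2) *
      |z p.1 - z p.2| ^ s i j
  have hs : ∀ i j, s i j ≤ (e i : ℕ) + e j ∧ s i j ≤ 2 * r - 1 := by
    rintro (i | i) (j | j) <;> simp [s, rowOrder, colOrder, e] <;> omega
  have hlim : Tendsto G (𝓝[>] (0 : ℝ)) (𝓝 M) := by
    refine tendsto_pi_nhds.mpr fun i => tendsto_pi_nhds.mpr fun j => ?_
    exact tendsto_entry_div_pow hz hf hr (e i) (e j) (hs i j).1 (hs i j).2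
  have hM : M = fromBlocks (wronskianMatrix f r) 0 M.toBlocks₂₁
      (taylorCoeff f (2 * r - 1) • compression z (distMatrix z (2 * r - 1))) := by
    ext (i | i) (j | j)
    · have h := taylorCoeff_mul_sum_eq hz hr (Fin.castAdd q i) (Fin.castAdd q j)
        (s := (i : ℕ) + j) le_rfl (by omega)
      simpa [M, s, rowOrder, colOrder, e, wronskianMatrix, ← hT] using h
    -- The exponent i + (r - 1) is below both i + (r + j) and 2r - 1, so nothing of this order
    -- survives.
    · have h := taylorCoeff_mul_sum_eq hz hr (Fin.castAdd q i) (Fin.natAdd r j)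
        (s := (i : ℕ) + (r - 1)) (by simp; omega) (by omega)
      rw [if_neg (by simp; omega)] at h
      rw [fromBlocks_apply₁₂, Matrix.zero_apply]
      simpa [M, s, rowOrder, colOrder, e, ← hT] using h
    · rfl
    · have h2 : r + (r - 1) = 2 * r - 1 := by omega
      rw [fromBlocks_apply₂₂, Matrix.smul_apply, compression, mul_mul_transpose_apply, smul_eq_mul]
      simp [M, s, rowOrder, colOrder, e, h2, annihilatorRows, distMatrix, ← hT]
  have hdet := ((continuous_id.matrix_det.tendsto M).comp hlim).const_mul
    ((vandermonde z).det ^ 2)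
  have hMdet : M.det = (wronskianMatrix f r).det *
      (taylorCoeff f (2 * r - 1) ^ q * (compression z (distMatrix z (2 * r - 1))).det) := by
    rw [hM, det_fromBlocks_zero₁₂, det_smul, Fintype.card_fin]
  simp only [id, hMdet] at hdet
  refine hdet.congr' ?_
  filter_upwards [self_mem_nhdsWithin] with ε hε
  have hε' : ε ≠ 0 := ne_of_gt hε
  rw [det_inv_vandermonde_conj hz (Matrix.of fun i j => f (ε * |z i - z j|)), mul_div_assoc]
  congr 1
  set K : Matrix (Fin (r + q)) (Fin (r + q)) ℝ := Matrix.of fun i j => f (ε * |z i - z j|)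
  have hG : G ε = Matrix.of fun i j => (ε ^ colOrder r q j)⁻¹ *
      (Matrix.of fun i j => (ε ^ rowOrder r q i)⁻¹ * (T * K * Tᵀ).submatrix e e i j) i j := by
    ext i j
    simp only [G, of_apply, submatrix_apply, mul_mul_transpose_apply, s, pow_add, K]
    field_simp
  simp only [Function.comp]
  rw [hG, det_mul_row, det_mul_column, det_submatrix_equiv_self, Finset.prod_inv_distrib,
    Finset.prod_inv_distrib, Finset.prod_pow_eq_pow_sum, Finset.prod_pow_eq_pow_sum, pow_add]
  field_simp
  rw [hT]

end Determinants

/-! ### Laws on subsets and the common weights. -/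

variable {n : ℕ}

lemma exists_pmf_of_weights (m : ℕ) (w : Finset (Fin n) → ℝ)
    (h0 : ∀ Y : Finset (Fin n), Y.card = m → 0 ≤ w Y)
    (hZ : 0 < ∑ Y ∈ Finset.univ.powersetCard m, w Y) :
    ∃ P : PMF (Finset (Fin n)), ∀ X, (P X).toReal =
      if X.card = m then w X / ∑ Y ∈ Finset.univ.powersetCard m, w Y else 0 := by
  set Z := ∑ Y ∈ Finset.univ.powersetCard m, w Y with hZdef
  have hnn : ∀ X : Finset (Fin n), 0 ≤ if X.card = m then w X / Z else 0 := by
    intro X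
    split_ifs with h
    · exact div_nonneg (h0 X h) hZ.le
    · exact le_rfl
  refine ⟨PMF.ofFintype (fun X => ENNReal.ofReal (if X.card = m then w X / Z else 0)) ?_,
    fun X => ?_⟩
  · rw [← ENNReal.ofReal_sum_of_nonneg fun X _ => hnn X, ENNReal.ofReal_eq_one,
      ← Finset.sum_filter, ← Finset.sum_div, div_eq_one_iff_eq hZ.ne', hZdef]
    refine Finset.sum_congr ?_ fun _ _ => rfl
    ext Y
    simp
  · rw [PMF.ofFintype_apply, ENNReal.toReal_ofReal (hnn X)]

lemma IsStationaryKernel.posSemidef_kernelMatrix {κ : ℝ → ℝ → ℝ} {f : ℝ → ℝ}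
    (h : IsStationaryKernel κ f) (x : Fin n → ℝ) (ε : ℝ) : (kernelMatrix κ x ε).PosSemidef :=
  h.posDef n fun i => ε * x i

lemma principalMinor_nonneg {L : Matrix (Fin n) (Fin n) ℝ} (hL : L.PosSemidef)
    (X : Finset (Fin n)) : 0 ≤ principalMinor L X :=
  (hL.submatrix _).det_nonneg

lemma rank_vandermondeLT {x : Fin n → ℝ} (hx : Function.Injective x) {r : ℕ} (hr : r ≤ n) :
    (vandermondeLT x r).rank = r := by
  have h := linearIndependent_cols_of_det_ne_zero (det_vandermonde_ne_zero_iff.mpr hx)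
  have h2 : LinearIndependent ℝ (vandermondeLT x r)ᵀ.row :=
    h.comp (Fin.castLE hr) (Fin.castLE_injective hr)
  rw [← rank_transpose, h2.rank_matrix, Fintype.card_fin]

theorem isNonnegativePair_distMatrix {x : Fin n → ℝ} (hx : Function.Injective x) {r : ℕ}
    (hr : 1 ≤ r) (hrn : r ≤ n) :
    IsNonnegativePair ((-1 : ℝ) ^ r • distMatrix x (2 * r - 1)) (vandermondeLT x r) where
  symm := by
    ext i j
    simp [distMatrix, abs_sub_comm]
  rank_eq := rank_vandermondeLT hx hrn
  nonneg c hc := by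
    rcases eq_or_ne c 0 with rfl | hc0
    · simp
    have hcm : ∀ k < r, ∑ i, c i * x i ^ k = 0 := by
      intro k hk
      have := congrFun hc ⟨k, hk⟩
      simp only [mulVec, dotProduct, transpose_apply, vandermondeLT, of_apply,
        Pi.zero_apply] at this
      rw [← this]
      exact Finset.sum_congr rfl fun i _ => mul_comm _ _
    refine (sum_dist_pow_pos hx hc0 hr hcm).le.trans_eq ?_
    rw [smul_mulVec, dotProduct_smul, smul_eq_mul]
    congr 1
    simp only [dotProduct, mulVec, Finset.mul_sum, distMatrix, of_apply]
    exact Finset.sum_congr rfl fun i _ => Finset.sum_congr rfl fun j _ => by ring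

section Enumeration

variable {m : ℕ} {X : Finset (Fin n)} (e : Fin m ≃ X)

lemma principalMinor_eq_det_submatrix (L : Matrix (Fin n) (Fin n) ℝ) :
    principalMinor L X = (L.submatrix (fun i => (e i : Fin n)) fun i => (e i : Fin n)).det := by
  rw [principalMinor, ← det_submatrix_equiv_self e]
  rfl

lemma saddleDet_eq_det_fromBlocks {p : ℕ} (L : Matrix (Fin n) (Fin n) ℝ)
    (V : Matrix (Fin n) (Fin p) ℝ) :
    saddleDet L V X = (fromBlocks (L.submatrix (fun i => (e i : Fin n)) fun i => (e i : Fin n))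
      (V.submatrix (fun i => (e i : Fin n)) id)
      (V.submatrix (fun i => (e i : Fin n)) id)ᵀ 0).det := by
  rw [saddleDet, ← det_submatrix_equiv_self (Equiv.sumCongr e (Equiv.refl (Fin p)))]
  congr 1
  ext (i | i) (j | j) <;> rfl

end Enumeration

/-- Up to a constant factor, saddle-point determinants and rescaled principal minors of the kernel
matrix in the flat limit are given by the same positive weights. -/
theorem exists_flatLimit_weights {x : Fin n → ℝ} (hx : Function.Injective x) {r : ℕ} (hr : 1 ≤ r)
    (q : ℕ) :
    ∃ w : Finset (Fin n) → ℝ, (∀ X : Finset (Fin n), X.card = r + q → 0 < w X) ∧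
      (∃ σ : ℝ, σ ≠ 0 ∧ ∀ X : Finset (Fin n), X.card = r + q →
        saddleDet ((-1 : ℝ) ^ r • distMatrix x (2 * r - 1)) (vandermondeLT x r) X = σ * w X) ∧
      (∃ σ : ℝ, σ ≠ 0 ∧ ∀ X : Finset (Fin n), X.card = r + q →
        saddleDet (distMatrix x (2 * r - 1)) (vandermondeLT x r) X = σ * w X) ∧
      ∀ (κ : ℝ → ℝ → ℝ) (f : ℝ → ℝ), IsStationaryKernel κ f → HasSmoothnessOrder f r →
        ∃ (C : ℝ) (d : ℕ), C ≠ 0 ∧ ∀ X : Finset (Fin n), X.card = r + q →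
          Tendsto (fun ε => principalMinor (kernelMatrix κ x ε) X / ε ^ d) (𝓝[>] (0 : ℝ))
            (𝓝 (C * w X)) := by
  classical
  let e : ∀ X : Finset (Fin n), X.card = r + q → (Fin (r + q) ≃ X) := fun X h =>
    (X.equivFinOfCardEq h).symm
  let z : ∀ X : Finset (Fin n), X.card = r + q → Fin (r + q) → ℝ := fun X h i => x (e X h i)
  have hz : ∀ X h, Function.Injective (z X h) := fun X h =>
    hx.comp (Subtype.val_injective.comp (e X h).injective)
  have hsign : ((-1 : ℝ) ^ r) ^ q ≠ 0 := pow_ne_zero _ (pow_ne_zero _ (by norm_num))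
  have hsq : ((-1 : ℝ) ^ r) ^ q * ((-1 : ℝ) ^ r) ^ q = 1 := by
    rw [← mul_pow, ← mul_pow]
    norm_num
  -- The sign (-1)^r sits inside `w` to make it positive; `hcomp` extracts it as a factor
  -- independent of `X`.
  let w : Finset (Fin n) → ℝ := fun X => if h : X.card = r + q then
    (vandermonde (z X h)).det ^ 2 *
      (compression (z X h) ((-1 : ℝ) ^ r • distMatrix (z X h) (2 * r - 1))).det else 0
  have hw : ∀ X (h : X.card = r + q), w X = (vandermonde (z X h)).det ^ 2 *
      (compression (z X h) ((-1 : ℝ) ^ r • distMatrix (z X h) (2 * r - 1))).det :=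
    fun X h => dif_pos h
  have hcomp : ∀ X (h : X.card = r + q), (vandermonde (z X h)).det ^ 2 *
      (compression (z X h) (distMatrix (z X h) (2 * r - 1))).det = ((-1 : ℝ) ^ r) ^ q * w X := by
    intro X h
    rw [hw X h, compression_smul, det_smul, Fintype.card_fin, mul_left_comm,
      ← mul_assoc (((-1 : ℝ) ^ r) ^ q) (((-1 : ℝ) ^ r) ^ q), hsq, one_mul]
  refine ⟨w, fun X h => ?_, ⟨(blockSwap r).det, det_blockSwap_ne_zero, fun X h => ?_⟩,
    ⟨(blockSwap r).det * ((-1 : ℝ) ^ r) ^ q, mul_ne_zero det_blockSwap_ne_zero hsign,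
      fun X h => ?_⟩, fun κ f hκ hf => ?_⟩
  · have h1 : (vandermonde (z X h)).det ≠ 0 := det_vandermonde_ne_zero_iff.mpr (hz X h)
    have h2 := (posDef_compression (hz X h) hr).det_pos
    rw [hw X h]
    positivity
  · rw [hw X h, ← det_fromBlocks_vandermondeLT (hz X h), saddleDet_eq_det_fromBlocks (e X h)]
    rfl
  · rw [mul_assoc, ← hcomp X h, ← det_fromBlocks_vandermondeLT (hz X h),
      saddleDet_eq_det_fromBlocks (e X h)]
    rfl
  · refine ⟨(wronskianMatrix f r).det * taylorCoeff f (2 * r - 1) ^ q * ((-1 : ℝ) ^ r) ^ q,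
      ∑ i, rowOrder r q i + ∑ i, colOrder r q i,
      mul_ne_zero (mul_ne_zero (det_wronskianMatrix_ne_zero hκ hf) (pow_ne_zero _ hf.1.2)) hsign,
      fun X h => ?_⟩
    have hlim := tendsto_det_div_pow (hz X h) hκ.analyticAt_zero hf
    have hC : (vandermonde (z X h)).det ^ 2 * ((wronskianMatrix f r).det *
        (taylorCoeff f (2 * r - 1) ^ q *
          (compression (z X h) (distMatrix (z X h) (2 * r - 1))).det)) =
        (wronskianMatrix f r).det * taylorCoeff f (2 * r - 1) ^ q * ((-1 : ℝ) ^ r) ^ q * w X := by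
      rw [mul_assoc _ (((-1 : ℝ) ^ r) ^ q), ← hcomp X h]
      ring
    rw [hC] at hlim
    refine hlim.congr' ?_
    filter_upwards [self_mem_nhdsWithin] with ε hε
    rw [principalMinor_eq_det_submatrix (e X h)]
    congr 2
    ext i j
    exact (hκ.scaled_eq hε _ _).symm

end FlatLimit

/-! ### Normalisation and the limit theorem. -/

theorem mainTheorem10 {n : ℕ} (x : Fin n → ℝ) (hx : Function.Injective x)
    (m r : ℕ) (hr : 1 ≤ r) (hrm : r ≤ m) (hmn : m ≤ n) :
    ∃ Pstar : PMF (Finset (Fin n)),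
      FlatLimit.IsFixedSizePPDPP ((-1 : ℝ) ^ r • FlatLimit.distMatrix x (2 * r - 1))
        (FlatLimit.vandermondeLT x r) m Pstar ∧
      (∀ X : Finset (Fin n), (Pstar X).toReal =
        FlatLimit.fixedSizeExtendedMass (FlatLimit.distMatrix x (2 * r - 1))
          (FlatLimit.vandermondeLT x r) m X) ∧
      ∀ (κ : ℝ → ℝ → ℝ) (f : ℝ → ℝ), FlatLimit.IsStationaryKernel κ f →
        FlatLimit.HasSmoothnessOrder f r →
        (∀ᶠ ε in 𝓝[>] (0 : ℝ), ∃ P : PMF (Finset (Fin n)),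
          FlatLimit.IsFixedSizeLEnsemble (FlatLimit.kernelMatrix κ x ε) m P) ∧
        ∀ P : ℝ → PMF (Finset (Fin n)),
          (∀ᶠ ε in 𝓝[>] (0 : ℝ),
            FlatLimit.IsFixedSizeLEnsemble (FlatLimit.kernelMatrix κ x ε) m (P ε)) →
          ∀ X : Finset (Fin n),
            Tendsto (fun ε => (P ε X).toReal) (𝓝[>] (0 : ℝ)) (𝓝 (Pstar X).toReal) := by
  obtain ⟨q, rfl⟩ := Nat.exists_eq_add_of_le hrm
  obtain ⟨w, hpos, ⟨σ, hσ, hsad⟩, ⟨σ', hσ', hsad'⟩, hlim⟩ :=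
    FlatLimit.exists_flatLimit_weights hx hr q
  have hmem : ∀ Y ∈ (Finset.univ : Finset (Fin n)).powersetCard (r + q), Y.card = r + q :=
    fun Y hY => (Finset.mem_powersetCard.mp hY).2
  have hZ : 0 < ∑ Y ∈ (Finset.univ : Finset (Fin n)).powersetCard (r + q), w Y := by
    refine Finset.sum_pos (fun Y hY => hpos Y (hmem Y hY)) ?_
    rw [Finset.powersetCard_nonempty]
    simpa using hmn
  obtain ⟨Pstar, hPstar⟩ := FlatLimit.exists_pmf_of_weights (r + q) w
    (fun Y hY => (hpos Y hY).le) hZ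
  have hmass : ∀ (L : Matrix (Fin n) (Fin n) ℝ) (τ : ℝ), τ ≠ 0 →
      (∀ X : Finset (Fin n), X.card = r + q →
        FlatLimit.saddleDet L (FlatLimit.vandermondeLT x r) X = τ * w X) →
      ∀ X, (Pstar X).toReal =
        FlatLimit.fixedSizeExtendedMass L (FlatLimit.vandermondeLT x r) (r + q) X := by
    intro L τ hτ hL X
    rw [hPstar, FlatLimit.fixedSizeExtendedMass]
    split_ifs with h
    · have hsum : ∑ Y ∈ Finset.univ.powersetCard (r + q),
          FlatLimit.saddleDet L (FlatLimit.vandermondeLT x r) Y =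
            τ * ∑ Y ∈ Finset.univ.powersetCard (r + q), w Y := by
        rw [Finset.mul_sum]
        exact Finset.sum_congr rfl fun Y hY => hL Y (hmem Y hY)
      rw [← Finset.mul_sum, hsum, hL X h, mul_div_mul_left _ _ (pow_ne_zero _ (by norm_num)),
        mul_div_mul_left _ _ hτ]
    · rfl
  refine ⟨Pstar, ⟨FlatLimit.isNonnegativePair_distMatrix hx hr (hrm.trans hmn),
    hmass _ σ hσ hsad⟩, hmass _ σ' hσ' hsad', fun κ f hκ hf => ?_⟩
  obtain ⟨C, d, hC, hminor⟩ := hlim κ f hκ hf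
  have hsum : Tendsto (fun ε => (∑ Y ∈ Finset.univ.powersetCard (r + q),
      FlatLimit.principalMinor (FlatLimit.kernelMatrix κ x ε) Y) / ε ^ d) (𝓝[>] (0 : ℝ))
      (𝓝 (C * ∑ Y ∈ Finset.univ.powersetCard (r + q), w Y)) := by
    simp_rw [Finset.sum_div, Finset.mul_sum]
    exact tendsto_finsetSum _ fun Y hY => hminor Y (hmem Y hY)
  have hCZ : C * ∑ Y ∈ Finset.univ.powersetCard (r + q), w Y ≠ 0 := mul_ne_zero hC hZ.ne'
  constructor
  -- The sign of C is not needed: the normaliser is eventually nonzero, and it is nonnegative by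
  -- positive semi-definiteness.
  · filter_upwards [hsum.eventually_ne hCZ] with ε hε
    have hpsd := hκ.posSemidef_kernelMatrix x ε
    have hne := (div_ne_zero_iff.mp hε).1
    obtain ⟨P, hP⟩ := FlatLimit.exists_pmf_of_weights (r + q)
      (FlatLimit.principalMinor (FlatLimit.kernelMatrix κ x ε))
      (fun Y _ => FlatLimit.principalMinor_nonneg hpsd Y)
      (lt_of_le_of_ne (Finset.sum_nonneg fun Y _ => FlatLimit.principalMinor_nonneg hpsd Y)
        hne.symm)
    exact ⟨P, hpsd, hP⟩
  · intro P hP X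
    rw [hPstar]
    split_ifs with h
    · have ht := (hminor X h).div hsum hCZ
      rw [mul_div_mul_left _ _ hC] at ht
      refine ht.congr' ?_
      filter_upwards [hP, self_mem_nhdsWithin] with ε hε hε0
      rw [hε.2 X, if_pos h]
      exact div_div_div_cancel_right₀ (pow_ne_zero _ (ne_of_gt hε0)) _ _
    · refine tendsto_const_nhds.congr' ?_
      filter_upwards [hP] with ε hε
      rw [hε.2 X, if_neg h]
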